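/- Let $A>0$ be real, let $n\ge 0$ be an integer, and let $c:S^1=\mathbb R/2\pi\mathbb Z\to\mathbb R^2$ be a smooth immersion, i.e. $c_\theta=\partial_\theta c$ vanishes nowhere. Put $v=c_\theta/|c_\theta|$, $ds=|c_\theta|\,d\theta$, $D_s=|c_\theta|^{-1}\partial_\theta$, let $L_{n,c}=I+(-1)^nA\,D_s^{2n}$ act on $C^\infty(S^1,\mathbb R^2)$, and define $$L^\top_c:C^\infty(S^1)\to C^\infty(S^1),\qquad L^\top_c(f)=\langle L_{n,c}(f\,v),v\rangle ,$$ where $C^\infty(S^1)=C^\infty(S^1,\mathbb R)$. Then: 1. $L^\top_c$ is invertible, i.e. a linear bijection of $C^\infty(S^1)$ onto itself. 2. $L^\top_c$ is a linear differential operator of order exactly $2n$: there are $a_0,\dots,a_{2n}\in C^\infty(S^1)$ with $a_{2n}\neq0$ such that $L^\top_c(f)=\sum_{j=0}^{2n}a_j\,\partial_\theta^jf$ for all $f\in C^\infty(S^1)$. If $n\ge1$, it is unbounded for the norm of $L^2(S^1,ds)$. 3. $L^\top_c$ is symmetric and positive: $\int_{S^1}L^\top_c(f)\,g\,ds=\int_{S^1}f\,L^\top_c(g)\,ds$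 for all $f,g\in C^\infty(S^1)$, and $\int_{S^1}L^\top_c(f)\,f\,ds>0$ for all $f\in C^\infty(S^1)$, $f\ne0$. 4. As an operator on the real Hilbert space $L^2(S^1,ds)$ with domain $C^\infty(S^1)$, $L^\top_c$ is densely defined and closable, and its closure $\overline{L^\top_c}$ is self-adjoint and positive: $\langle \overline{L^\top_c}u,u\rangle_{L^2(ds)}>0$ for all $u\neq0$ in its domain. -/

import Mathlib

open scoped ContDiff RealInnerProductSpace

noncomputable section

namespace PlaneCurve

/-- The circle `S¹ = ℝ / 2πℤ`, with angular coordinate `θ`. -/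
abbrev S1 : Type := AddCircle (2 * Real.pi)

instance fact_two_pi_pos : Fact (0 < 2 * Real.pi) := ⟨Real.two_pi_pos⟩

/-- The Euclidean plane `ℝ²`. -/
abbrev Plane : Type := EuclideanSpace ℝ (Fin 2)

/-- `C^∞(S¹, E)`: functions on the circle whose `2π`-periodic lift to `ℝ` is smooth. -/
def Smooth (E : Type) [NormedAddCommGroup E] [NormedSpace ℝ E] : Submodule ℝ (S1 → E) where
  carrier := {f | ContDiff ℝ ∞ (fun t : ℝ => f (t : S1))}
  add_mem' hf hg := by
    simp only [Set.mem_ofPred_eq] at hf hg ⊢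
    exact hf.add hg
  zero_mem' := by
    simp only [Set.mem_ofPred_eq]
    exact contDiff_const
  smul_mem' r _ hf := by
    simp only [Set.mem_ofPred_eq] at hf ⊢
    exact hf.const_smul r

section Calculus

variable {E : Type} [NormedAddCommGroup E] [NormedSpace ℝ E]

/-- The derivative `∂_θ f` of a function on the circle. -/
def angDeriv (f : S1 → E) (x : S1) : E := deriv (fun t : ℝ => f (x + (t : S1))) 0

theorem angDeriv_coe (f : S1 → E) (s : ℝ) :
    angDeriv f (s : S1) = deriv (fun t : ℝ => f (t : S1)) s := by
  have h := deriv_comp_const_add (f := fun t : ℝ => f (t : S1)) s 0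
  simp only [add_zero] at h
  simpa [angDeriv, AddCircle.coe_add] using h

theorem contDiff_lift (f : Smooth E) : ContDiff ℝ ∞ (fun t : ℝ => f.1 (t : S1)) := f.2

theorem continuous_smooth (f : Smooth E) : Continuous f.1 :=
  (QuotientAddGroup.isQuotientMap_mk _).continuous_iff.2 (contDiff_lift f).continuous

theorem angDeriv_mem (f : Smooth E) : angDeriv f.1 ∈ Smooth E := by
  change ContDiff ℝ ∞ (fun t : ℝ => angDeriv f.1 (t : S1))
  simp only [angDeriv_coe]
  exact (contDiff_infty_iff_deriv.1 (contDiff_lift f)).2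

/-- `∂_θ` as a linear map of `C^∞(S¹, E)`. -/
def dTheta : Smooth E →ₗ[ℝ] Smooth E where
  toFun f := ⟨angDeriv f.1, angDeriv_mem f⟩
  map_add' f g := by
    ext x
    induction x using QuotientAddGroup.induction_on with
    | H s =>
      change angDeriv (f.1 + g.1) (s : S1) = angDeriv f.1 (s : S1) + angDeriv g.1 (s : S1)
      simp only [angDeriv_coe]
      exact deriv_add (((contDiff_lift f).differentiable (by simp)) s)
        (((contDiff_lift g).differentiable (by simp)) s)
  map_smul' r f := by
    ext x
    induction x using QuotientAddGroup.induction_on with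
    | H s =>
      change angDeriv (r • f.1) (s : S1) = r • angDeriv f.1 (s : S1)
      simp only [angDeriv_coe]
      exact deriv_const_smul r (((contDiff_lift f).differentiable (by simp)) s)

/-- The pointwise product `a • h`, linear in `h ∈ C^∞(S¹, E)`, for `a ∈ C^∞(S¹)`. -/
def mulLeft (a : Smooth ℝ) : Smooth E →ₗ[ℝ] Smooth E where
  toFun h := ⟨fun x => a.1 x • h.1 x, ContDiff.smul (contDiff_lift a) (contDiff_lift h)⟩
  map_add' h k := by ext x; simp
  map_smul' r h := by ext x; exact smul_comm _ _ _

/-- The pointwise product `f • h`, linear in `f ∈ C^∞(S¹)`, for `h ∈ C^∞(S¹, E)`. -/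
def mulRight (h : Smooth E) : Smooth ℝ →ₗ[ℝ] Smooth E where
  toFun f := ⟨fun x => f.1 x • h.1 x, ContDiff.smul (contDiff_lift f) (contDiff_lift h)⟩
  map_add' f g := by ext x; simp [add_smul]
  map_smul' r f := by ext x; simp [mul_smul]

end Calculus

/-- The pointwise inner product `⟨h, k⟩`, linear in `h ∈ C^∞(S¹, ℝ²)`. -/
def innerWith (k : Smooth Plane) : Smooth Plane →ₗ[ℝ] Smooth ℝ where
  toFun h := ⟨fun x => ⟪h.1 x, k.1 x⟫, ContDiff.inner ℝ (contDiff_lift h) (contDiff_lift k)⟩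
  map_add' h₁ h₂ := by ext x; simp [inner_add_left]
  map_smul' r h := by ext x; simp [inner_smul_left]

/-- `Imm(S¹, ℝ²)`: smooth maps `c : S¹ → ℝ²` with `c_θ` nowhere zero. -/
structure Imm where
  curve : Smooth Plane
  immersed : ∀ x : S1, (dTheta curve).1 x ≠ 0

namespace Imm

variable (c : Imm)

/-- The speed `|c_θ|`. -/
def speed (x : S1) : ℝ := ‖(dTheta c.curve).1 x‖

theorem speed_pos (x : S1) : 0 < c.speed x := norm_pos_iff.2 (c.immersed x)

theorem continuous_speed : Continuous c.speed := (continuous_smooth (dTheta c.curve)).norm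

/-- The function `1 / |c_θ|`. -/
def speedInv : Smooth ℝ :=
  ⟨fun x => (c.speed x)⁻¹,
    ContDiff.inv (ContDiff.norm ℝ (contDiff_lift (dTheta c.curve)) (fun t => c.immersed t))
      (fun t => (c.speed_pos t).ne')⟩

/-- The arclength derivative `D_s = ∂_θ / |c_θ|`. -/
def Ds : Smooth Plane →ₗ[ℝ] Smooth Plane := mulLeft c.speedInv ∘ₗ dTheta

/-- The unit tangent vector `v = c_θ / |c_θ|`. -/
def tangent : Smooth Plane := mulLeft c.speedInv (dTheta c.curve)

/-- The operator `L_{n,c} = I + (-1)^n A D_s^{2n}` on `C^∞(S¹, ℝ²)`. -/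
def L (A : ℝ) (n : ℕ) : Smooth Plane →ₗ[ℝ] Smooth Plane :=
  LinearMap.id + ((-1) ^ n * A) • (c.Ds ^ (2 * n))

/-- The operator `L^⊤_c (f) = ⟨L_{n,c} (f v), v⟩` on `C^∞(S¹)`. -/
def Ltop (A : ℝ) (n : ℕ) : Smooth ℝ →ₗ[ℝ] Smooth ℝ :=
  innerWith c.tangent ∘ₗ c.L A n ∘ₗ mulRight c.tangent

/-- The arclength measure `ds = |c_θ| dθ` on the circle. -/
def ds : MeasureTheory.Measure S1 :=
  MeasureTheory.volume.withDensity (fun x => ENNReal.ofReal (c.speed x))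

instance isFiniteMeasure_ds : MeasureTheory.IsFiniteMeasure c.ds := by
  apply MeasureTheory.isFiniteMeasure_withDensity_ofReal
  exact (c.continuous_speed.integrable_of_hasCompactSupport
    (HasCompactSupport.of_compactSpace _)).2

instance isOpenPosMeasure_ds : c.ds.IsOpenPosMeasure := by
  have h : MeasureTheory.Measure.AbsolutelyContinuous
      (MeasureTheory.volume : MeasureTheory.Measure S1) c.ds :=
    MeasureTheory.withDensity_absolutelyContinuous'
      c.continuous_speed.measurable.ennreal_ofReal.aemeasurable
      (Filter.Eventually.of_forall fun x => by simpa using c.speed_pos x)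
  exact h.isOpenPosMeasure

/-- The real Hilbert space `L²(ds)`. -/
abbrev L2 : Type := MeasureTheory.Lp ℝ 2 c.ds

/-- The inclusion `C^∞(S¹) → L²(ds)`. -/
def toL2 : Smooth ℝ →ₗ[ℝ] c.L2 :=
  (ContinuousMap.toLp 2 c.ds ℝ).toLinearMap ∘ₗ
    { toFun := fun f => (⟨f.1, (continuous_smooth f)⟩ : C(S1, ℝ))
      map_add' := fun _ _ => rfl
      map_smul' := fun _ _ => rfl }

theorem toL2_injective : Function.Injective c.toL2 := by
  intro f g h
  have := ContinuousMap.toLp_injective (p := 2) (𝕜 := ℝ) c.ds h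
  exact Subtype.ext (congrArg DFunLike.coe this)

/-- A linear operator `P` of `C^∞(S¹)`, viewed as an unbounded operator on `L²(ds)` with domain
`C^∞(S¹)`. -/
def asUnbounded (P : Smooth ℝ →ₗ[ℝ] Smooth ℝ) : c.L2 →ₗ.[ℝ] c.L2 where
  domain := LinearMap.range c.toL2
  toFun := c.toL2 ∘ₗ P ∘ₗ (LinearEquiv.ofInjective c.toL2 c.toL2_injective).symm.toLinearMap

end Imm

/-- `P` is a differential operator on the circle with smooth coefficients, of order exactly `N`. -/
def IsDiffOpOfOrder (N : ℕ) (P : Smooth ℝ →ₗ[ℝ] Smooth ℝ) : Prop :=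
  ∃ a : ℕ → Smooth ℝ, a N ≠ 0 ∧
    ∀ f : Smooth ℝ, P f = ∑ j ∈ Finset.range (N + 1), mulLeft (a j) ((dTheta ^ j) f)

end PlaneCurve

end

/-!
The starting point is the energy identity
`∫ L^⊤(f) g ds = ∫ f g ds + A ∫ ⟨D_s^n (f v), D_s^n (g v)⟩ ds`
(`PlaneCurve.Imm.integral_Ltop_mul`), obtained by integrating by parts `n` times.

The identity is symmetric in `f` and `g` and gives `⟨L^⊤ f, f⟩ ≥ ‖f‖²`, hence symmetry, positivity
and injectivity. By the Leibniz rule `L^⊤` is a differential operator whose coefficient of order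
`2n` is `(-1)^n A |c_θ|^{-2n}` for `n ≥ 1` and `1 + A` for `n = 0`, which vanishes nowhere
(`PlaneCurve.Imm.exists_coeff_Ltop`).

Surjectivity comes from injectivity by the Fredholm alternative for periodic linear systems
(`exists_periodic_solution_of_unique`). The initial value problem on one period is solved through the
Volterra operator, whose powers tend to zero. The initial values of the periodic solutions are then
the solutions of a linear equation in a finite-dimensional space, whose linear part is injective.
A scalar operator of order `N` is a companion system of size `N`, and its continuous solutions are
smooth because the coefficients are.

A symmetric operator `T` on a Hilbert space with `⟨T x, x⟩ ≥ ‖x‖²` and dense range has a surjective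
closure, and a symmetric surjective operator is self-adjoint
(`LinearPMap.isSelfAdjoint_closure_of_denseRange`). Here the range is all of `C^∞(S¹)`, which is
dense in `L²(ds)` by Stone–Weierstrass. Unboundedness for `n ≥ 1` is seen on `cos kθ` and `sin kθ`
as `k → ∞` (`PlaneCurve.Imm.not_bounded_of_leadingCoeff_ne_zero`).
-/

/-! ### Essential self-adjointness -/

section EssentialSelfAdjointness

variable {H : Type*} [NormedAddCommGroup H] [InnerProductSpace ℝ H] {T : H →ₗ.[ℝ] H}

theorem LinearPMap.IsFormalAdjoint.isClosable [CompleteSpace H] (hs : T.IsFormalAdjoint T)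
    (hd : Dense (T.domain : Set H)) : T.IsClosable :=
  (T.adjoint_isClosed hd).isClosable.leIsClosable (hs.le_adjoint hd)

theorem LinearPMap.mem_closure_graph_iff (hc : T.IsClosable) (p : H × H) :
    p ∈ T.closure.graph ↔ p ∈ _root_.closure (T.graph : Set (H × H)) := by
  rw [← hc.graph_closure_eq_closure_graph]
  rfl

/-- A relation between `u` and `T u` that is closed in `(u, T u)` passes from a closable operator
to its closure. -/
theorem LinearPMap.closure_induction (hc : T.IsClosable) {p : H × H → Prop}
    (hp : _root_.IsClosed {z | p z}) (h : ∀ x : T.domain, p ((x : H), T x)) (u : T.closure.domain) :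
    p ((u : H), T.closure u) := by
  have hu : ((u : H), T.closure u) ∈ _root_.closure (T.graph : Set (H × H)) :=
    (LinearPMap.mem_closure_graph_iff hc _).1 (T.closure.mem_graph u)
  refine closure_minimal ?_ hp hu
  intro z hz
  obtain ⟨x, hx⟩ := T.mem_graph_iff.1 hz
  have := h x
  rw [hx.1, hx.2] at this
  exact this

theorem LinearPMap.norm_sq_le_inner_closure (hc : T.IsClosable)
    (h : ∀ x : T.domain, ‖(x : H)‖ ^ 2 ≤ inner ℝ (T x) (x : H)) (u : T.closure.domain) :
    ‖(u : H)‖ ^ 2 ≤ inner ℝ (T.closure u) (u : H) :=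
  LinearPMap.closure_induction hc (p := fun z => ‖z.1‖ ^ 2 ≤ inner ℝ z.2 z.1)
    (isClosed_le (by fun_prop) (by fun_prop)) h u

theorem LinearPMap.IsFormalAdjoint.closure (hc : T.IsClosable) (hs : T.IsFormalAdjoint T) :
    T.closure.IsFormalAdjoint T.closure := by
  intro u w
  refine LinearPMap.closure_induction hc
    (p := fun z => inner ℝ (T.closure u) z.1 = inner ℝ (u : H) z.2)
    (isClosed_eq (by fun_prop) (by fun_prop)) (fun x => ?_) w
  exact LinearPMap.closure_induction hc
    (p := fun z => inner ℝ z.2 (x : H) = inner ℝ z.1 (T x))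
    (isClosed_eq (by fun_prop) (by fun_prop)) (fun y => hs y x) u

/-- The lower bound `‖x‖ ≤ ‖T x‖` makes the range of the closure closed, so a dense range of `T`
becomes surjectivity of the closure. -/
theorem LinearPMap.closure_surjective_of_denseRange [CompleteSpace H] (hc : T.IsClosable)
    (h : ∀ x : T.domain, ‖(x : H)‖ ≤ ‖T x‖) (hr : DenseRange T) :
    Function.Surjective T.closure := by
  have hclosed : _root_.IsClosed (T.closure.graph : Set (H × H)) := hc.closure_isClosed
  have : CompleteSpace T.closure.graph := hclosed.completeSpace_coe
  have hbound (u : T.closure.domain) : ‖(u : H)‖ ≤ ‖T.closure u‖ :=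
    LinearPMap.closure_induction hc (p := fun z => ‖z.1‖ ≤ ‖z.2‖)
      (isClosed_le (by fun_prop) (by fun_prop)) h u
  -- the projection of the graph to the second factor is a closed embedding
  let π : T.closure.graph →ₗ[ℝ] H := LinearMap.snd ℝ H H ∘ₗ T.closure.graph.subtype
  have hanti : AntilipschitzWith 1 π := by
    refine AddMonoidHomClass.antilipschitz_of_bound π fun z => ?_
    obtain ⟨u, hu⟩ := T.closure.mem_graph_iff.1 z.2
    have h1 : ‖z.1.1‖ ≤ ‖z.1.2‖ := by rw [← hu.1, ← hu.2]; exact hbound u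
    rw [NNReal.coe_one, one_mul]
    exact max_le h1 le_rfl
  have hunif : UniformContinuous π :=
    uniformContinuous_snd.comp uniformContinuous_subtype_val
  have hrange : _root_.IsClosed (Set.range π) := hanti.isClosed_range hunif
  intro w
  have hw : w ∈ Set.range π := by
    refine closure_minimal ?_ hrange (hr w)
    rintro _ ⟨x, rfl⟩
    exact ⟨⟨((x : H), T x), LinearPMap.le_graph_of_le T.le_closure (T.mem_graph x)⟩, rfl⟩
  obtain ⟨z, rfl⟩ := hw
  obtain ⟨u, hu⟩ := T.closure.mem_graph_iff.1 z.2
  exact ⟨u, hu.2⟩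

/-- A surjective symmetric operator has no proper symmetric extension, and so is self-adjoint. -/
theorem LinearPMap.isSelfAdjoint_of_surjective [CompleteSpace H] (hd : Dense (T.domain : Set H))
    (hs : T.IsFormalAdjoint T) (hsurj : Function.Surjective T) : IsSelfAdjoint T := by
  have hle : T ≤ T.adjoint := hs.le_adjoint hd
  rw [LinearPMap.isSelfAdjoint_def]
  refine (LinearPMap.eq_of_le_of_domain_eq hle (le_antisymm hle.1 fun u hu => ?_)).symm
  obtain ⟨x, hx⟩ := hsurj (T.adjoint ⟨u, hu⟩)
  have hux : u = x := by
    rw [← sub_eq_zero, ← inner_self_eq_zero (𝕜 := ℝ)]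
    -- `u - x` is orthogonal to the range of `T`, that is to everything
    obtain ⟨y, hy⟩ := hsurj (u - x)
    have h1 := (T.adjoint_isFormalAdjoint hd) ⟨u, hu⟩ y
    have h2 := hs x y
    rw [hx] at h2
    rw [h1] at h2
    nth_rewrite 2 [← hy]
    rw [inner_sub_left, sub_eq_zero]
    exact h2
  rw [hux]
  exact x.2

theorem LinearPMap.isSelfAdjoint_closure_of_denseRange [CompleteSpace H]
    (hd : Dense (T.domain : Set H)) (hs : T.IsFormalAdjoint T)
    (h : ∀ x : T.domain, ‖(x : H)‖ ^ 2 ≤ inner ℝ (T x) (x : H)) (hr : DenseRange T) :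
    IsSelfAdjoint T.closure := by
  have hc := hs.isClosable hd
  refine LinearPMap.isSelfAdjoint_of_surjective (hd.mono T.le_closure.1) (hs.closure hc)
    (LinearPMap.closure_surjective_of_denseRange hc (fun x => ?_) hr)
  have h1 := (h x).trans (real_inner_le_norm _ _)
  nlinarith [norm_nonneg (x : H), norm_nonneg (T x)]

end EssentialSelfAdjointness

/-! ### Periodic solutions of linear systems -/

section PeriodicLinearODE

open Set intervalIntegral MeasureTheory
open scoped BoundedContinuousFunction

variable {E : Type*} [NormedAddCommGroup E] [NormedSpace ℝ E]

/-- The primitive `t ↦ ∫₀ᵗ g` on `[0, T]`, extended to `ℝ` by its end values, which makes it a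
bounded continuous function. -/
noncomputable def clampedPrimitive {T : ℝ} (hT : 0 ≤ T) (g : ℝ → E) (hg : Continuous g) : ℝ →ᵇ E :=
  BoundedContinuousFunction.compContinuous
    (BoundedContinuousFunction.mkOfCompact
      (⟨fun t : Icc 0 T => ∫ s in (0 : ℝ)..t, g s,
        (continuous_primitive (fun _ _ => hg.intervalIntegrable _ _) 0).comp
          continuous_subtype_val⟩ : C(Icc 0 T, E)))
    ⟨projIcc 0 T hT, continuous_projIcc⟩

theorem clampedPrimitive_apply {T : ℝ} (hT : 0 ≤ T) (g : ℝ → E) (hg : Continuous g) (t : ℝ) :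
    clampedPrimitive hT g hg t = ∫ s in (0 : ℝ)..(projIcc 0 T hT t : ℝ), g s := rfl

theorem clampedPrimitive_of_mem {T : ℝ} (hT : 0 ≤ T) (g : ℝ → E) (hg : Continuous g) {t : ℝ}
    (ht : t ∈ Icc 0 T) : clampedPrimitive hT g hg t = ∫ s in (0 : ℝ)..t, g s := by
  rw [clampedPrimitive_apply, projIcc_of_mem hT ht]

variable {B : ℝ → E →L[ℝ] E}

theorem norm_clampedPrimitive_clm_apply_le {T K : ℝ} (hT : 0 ≤ T)
    (hK : ∀ t ∈ Icc 0 T, ‖B t‖ ≤ K) {g : ℝ → E} {M : ℝ} {k : ℕ}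
    (hg : Continuous fun s => B s (g s)) (hM : ∀ t ∈ Icc 0 T, ‖g t‖ ≤ M * t ^ k) (t : ℝ) :
    ‖clampedPrimitive hT (fun s => B s (g s)) hg t‖
      ≤ K * M / (k + 1) * (projIcc 0 T hT t : ℝ) ^ (k + 1) := by
  rw [clampedPrimitive_apply]
  generalize projIcc 0 T hT t = p
  have hτ' : (p : ℝ) ∈ Icc 0 T := p.2
  generalize (p : ℝ) = τ at hτ'
  have hK0 : 0 ≤ K := (norm_nonneg _).trans (hK 0 ⟨le_rfl, hT⟩)
  calc ‖∫ s in (0 : ℝ)..τ, B s (g s)‖ ≤ ∫ s in (0 : ℝ)..τ, K * M * s ^ k := by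
        refine norm_integral_le_of_norm_le hτ'.1 (Filter.Eventually.of_forall fun s hs => ?_)
          (Continuous.intervalIntegrable (by fun_prop) _ _)
        have hs' : s ∈ Icc 0 T := ⟨hs.1.le, hs.2.trans hτ'.2⟩
        rw [mul_assoc]
        exact (B s).le_of_opNorm_le_of_le (hK s hs') (hM s hs')
    _ = K * M / (k + 1) * τ ^ (k + 1) := by
        rw [intervalIntegral.integral_const_mul, integral_pow]
        simp
        ring

/-- The Volterra operator `Y ↦ ∫₀ᵗ B Y` on `[0, T]`. -/
noncomputable def volterra {T K : ℝ} (hT : 0 ≤ T) (hB : Continuous B)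
    (hK : ∀ t ∈ Icc 0 T, ‖B t‖ ≤ K) :
    (ℝ →ᵇ E) →L[ℝ] (ℝ →ᵇ E) :=
  LinearMap.mkContinuous
    { toFun := fun Y => clampedPrimitive hT (fun s => B s (Y s)) (hB.clm_apply Y.continuous)
      map_add' := fun Y Z => by
        ext t
        simp only [clampedPrimitive_apply, BoundedContinuousFunction.add_apply, map_add]
        exact integral_add ((hB.clm_apply Y.continuous).intervalIntegrable _ _)
          ((hB.clm_apply Z.continuous).intervalIntegrable _ _)
      map_smul' := fun r Y => by
        ext t
        simp [clampedPrimitive_apply] }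
    (K * T) (fun Y => by
      have hK0 : 0 ≤ K := (norm_nonneg _).trans (hK 0 ⟨le_rfl, hT⟩)
      refine (BoundedContinuousFunction.norm_le (by positivity)).2 fun t => ?_
      refine (norm_clampedPrimitive_clm_apply_le (M := ‖Y‖) (k := 0) hT hK
        (hB.clm_apply Y.continuous) (fun t _ => by simpa using Y.norm_coe_le_norm t) t).trans ?_
      have := (projIcc 0 T hT t).2.2
      have h2 : 0 ≤ K * ‖Y‖ := by positivity
      simp only [Nat.cast_zero, zero_add, div_one, pow_one]
      nlinarith)

theorem volterra_apply {T K : ℝ} (hT : 0 ≤ T) (hB : Continuous B)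
    (hK : ∀ t ∈ Icc 0 T, ‖B t‖ ≤ K) (Y : ℝ →ᵇ E) :
    volterra hT hB hK Y =
      clampedPrimitive hT (fun s => B s (Y s)) (hB.clm_apply Y.continuous) := rfl

/-- Pointwise, the iterated integrals gain the factor `t ^ k / k!`. -/
theorem norm_volterra_pow_apply_le {T K : ℝ} (hT : 0 ≤ T) (hB : Continuous B)
    (hK : ∀ t ∈ Icc 0 T, ‖B t‖ ≤ K) (k : ℕ) (Y : ℝ →ᵇ E) :
    ∀ t ∈ Icc 0 T, ‖(volterra hT hB hK ^ k) Y t‖ ≤ K ^ k * ‖Y‖ / k.factorial * t ^ k := by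
  induction k with
  | zero => intro t _; simpa using Y.norm_coe_le_norm t
  | succ k ih =>
    intro t ht
    rw [pow_succ', mul_apply_eq_comp, volterra_apply]
    refine (norm_clampedPrimitive_clm_apply_le hT hK _ ih t).trans (le_of_eq ?_)
    rw [projIcc_of_mem hT ht, Nat.factorial_succ]
    push_cast
    have : (k.factorial : ℝ) ≠ 0 := by positivity
    field_simp
    ring

theorem norm_volterra_pow_succ_le {T K : ℝ} (hT : 0 ≤ T) (hB : Continuous B)
    (hK : ∀ t ∈ Icc 0 T, ‖B t‖ ≤ K) (k : ℕ) :
    ‖volterra hT hB hK ^ (k + 1)‖ ≤ (K * T) ^ (k + 1) / (k + 1).factorial := by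
  have hK0 : 0 ≤ K := (norm_nonneg _).trans (hK 0 ⟨le_rfl, hT⟩)
  refine ContinuousLinearMap.opNorm_le_bound _ (by positivity) fun Y => ?_
  refine (BoundedContinuousFunction.norm_le (by positivity)).2 fun t => ?_
  -- functions in the range of the Volterra operator are constant outside `[0, T]`
  have hproj : (volterra hT hB hK ^ (k + 1)) Y t
      = (volterra hT hB hK ^ (k + 1)) Y (projIcc 0 T hT t) := by
    rw [pow_succ', mul_apply_eq_comp, volterra_apply, clampedPrimitive_apply,
      clampedPrimitive_apply, projIcc_val]
  rw [hproj]
  have hτ := (projIcc 0 T hT t).2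
  refine (norm_volterra_pow_apply_le hT hB hK (k + 1) Y _ hτ).trans ?_
  calc K ^ (k + 1) * ‖Y‖ / (k + 1).factorial * (projIcc 0 T hT t : ℝ) ^ (k + 1)
      ≤ K ^ (k + 1) * ‖Y‖ / (k + 1).factorial * T ^ (k + 1) := by
        gcongr
        · exact hτ.1
        · exact hτ.2
    _ = (K * T) ^ (k + 1) / (k + 1).factorial * ‖Y‖ := by rw [mul_pow]; ring

variable [CompleteSpace E]

/-- The powers of the Volterra operator tend to zero, so `1 - V` divides a Neumann-invertible
operator. -/
theorem isUnit_one_sub_volterra {T K : ℝ} (hT : 0 ≤ T) (hB : Continuous B)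
    (hK : ∀ t ∈ Icc 0 T, ‖B t‖ ≤ K) : IsUnit (1 - volterra hT hB hK) := by
  set V := volterra hT hB hK
  have hlim := (FloorSemiring.tendsto_pow_div_factorial_atTop (K * T)).comp
    (Filter.tendsto_add_atTop_nat 1)
  obtain ⟨k, hk⟩ := (hlim.eventually (gt_mem_nhds one_pos)).exists
  have hunit : IsUnit (1 - V ^ (k + 1)) :=
    isUnit_one_sub_of_norm_lt_one ((norm_volterra_pow_succ_le hT hB hK k).trans_lt hk)
  rw [← mul_neg_geom_sum] at hunit
  have hcomm : Commute (1 - V) (∑ i ∈ Finset.range (k + 1), V ^ i) :=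
    Commute.sum_right _ _ _ fun i _ =>
      ((Commute.one_left V).sub_left (Commute.refl V)).pow_right i
  exact (hcomm.isUnit_mul_iff.1 hunit).1

/-- The solution operator of the integral equation `Y = F + ∫₀ᵗ B Y` on `[0, T]`. -/
theorem exists_volterra_resolvent {T : ℝ} (hT : 0 ≤ T) (hB : Continuous B) :
    ∃ S : (ℝ →ᵇ E) →L[ℝ] (ℝ →ᵇ E), ∀ F : ℝ →ᵇ E, ∀ t ∈ Icc 0 T,
      S F t = F t + ∫ s in (0 : ℝ)..t, B s (S F s) := by
  obtain ⟨K, hK⟩ := isCompact_Icc.exists_bound_of_continuousOn (s := Icc 0 T) hB.continuousOn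
  obtain ⟨u, hu⟩ := isUnit_one_sub_volterra hT hB hK
  refine ⟨u.inv, fun F t ht => ?_⟩
  have h : u.val (u.inv F) = F := by
    rw [← mul_apply_eq_comp, u.val_inv]
    rfl
  rw [hu] at h
  have ht' := congrArg (fun Z : ℝ →ᵇ E => Z t) h
  simp only [sub_apply, one_apply_eq_self,
    BoundedContinuousFunction.sub_apply, volterra_apply, clampedPrimitive_of_mem hT _ _ ht] at ht'
  rw [sub_eq_iff_eq_add] at ht'
  exact ht'

/-- A solution on `[0, T]` of an integral equation with `T`-periodic right-hand side that takes the
same value at both ends extends to a `T`-periodic solution of the differential equation. -/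
theorem exists_periodic_extension {T : ℝ} (hT : 0 < T) {f : ℝ → E → E}
    (hf : Continuous fun p : ℝ × E => f p.1 p.2) (hfp : ∀ t x, f (t + T) x = f t x) {Y : ℝ → E}
    (hYc : Continuous Y) {y₀ : E} (hYT : Y T = y₀)
    (hY : ∀ t ∈ Icc 0 T, Y t = y₀ + ∫ s in (0 : ℝ)..t, f s (Y s)) :
    ∃ y : ℝ → E, (∀ t, HasDerivAt y (f t (y t)) t) ∧ Function.Periodic y T ∧ y 0 = y₀ := by
  have hTf : Fact (0 < T) := ⟨hT⟩
  have hY0 : Y 0 = y₀ := by simpa using hY 0 ⟨le_rfl, hT.le⟩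
  let y : ℝ → E := fun t => AddCircle.liftIco T 0 Y (t : AddCircle T)
  have hyp : Function.Periodic y T := fun t => by simp [y]
  have hyc : Continuous y :=
    (AddCircle.liftIco_continuous (by simp [hY0, hYT]) hYc.continuousOn).comp
      (AddCircle.continuous_mk' T)
  have hyIco : ∀ t ∈ Ico 0 T, y t = Y t := fun t ht =>
    AddCircle.liftIco_coe_apply (by simpa using ht)
  have hyT : y T = Y T := by
    have h0 := hyp 0
    rw [zero_add] at h0
    rw [h0, hyIco 0 ⟨le_rfl, hT⟩, hY0, hYT]
  have hyY : ∀ t ∈ Icc 0 T, y t = Y t := fun t ht => by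
    rcases ht.2.eq_or_lt with rfl | h
    · exact hyT
    · exact hyIco t ⟨ht.1, h⟩
  let g : ℝ → E := fun s => f s (y s)
  have hgc : Continuous g := hf.comp (continuous_id.prodMk hyc)
  have hgp : Function.Periodic g T := fun s => by simp only [g, hyp s, hfp]
  have hint : ∀ t ∈ Icc 0 T, ∫ s in (0 : ℝ)..t, g s = ∫ s in (0 : ℝ)..t, f s (Y s) := by
    intro t ht
    refine integral_congr fun s hs => ?_
    rw [uIcc_of_le ht.1] at hs
    simp only [g, hyY s ⟨hs.1, hs.2.trans ht.2⟩]
  -- the equation at `t = T` says that `g` has mean zero, so its primitive is periodic too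
  have hzero : ∫ s in (0 : ℝ)..T, g s = 0 := by
    rw [hint T ⟨hT.le, le_rfl⟩]
    have := hY T ⟨hT.le, le_rfl⟩
    rw [hYT] at this
    simpa using this
  have hRp : Function.Periodic (fun t => y₀ + ∫ s in (0 : ℝ)..t, g s) T := fun t => by
    have := hgp.intervalIntegral_add_eq t 0
    rw [zero_add, hzero] at this
    simp only
    rw [← integral_add_adjacent_intervals (hgc.intervalIntegrable 0 t)
      (hgc.intervalIntegrable t (t + T)), this, add_zero]
  have hyR : y = fun t => y₀ + ∫ s in (0 : ℝ)..t, g s := by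
    have hIcc : ∀ t ∈ Icc 0 T, y t = y₀ + ∫ s in (0 : ℝ)..t, g s := fun t ht => by
      rw [hyY t ht, hint t ht, ← hY t ht]
    funext t
    obtain ⟨t', ht', h⟩ := (hyp.sub hRp).exists_mem_Ico₀ hT t
    simp only [Pi.sub_apply, hIcc t' (Ico_subset_Icc_self ht'), sub_self] at h
    exact sub_eq_zero.1 h
  refine ⟨y, fun t => ?_, hyp, by rw [hyIco 0 ⟨le_rfl, hT⟩, hY0]⟩
  have := (integral_hasDerivAt_right (hgc.intervalIntegrable 0 t)
    (hgc.stronglyMeasurableAtFilter _ _) hgc.continuousAt).const_add y₀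
  rw [← hyR] at this
  exact this

/-- The Fredholm alternative for periodic linear systems: if the homogeneous system has no nonzero
`T`-periodic solution, the inhomogeneous one has a `T`-periodic solution. The map `y₀ ↦ y₀ - Y(T)`,
with `Y` the solution of the homogeneous system starting at `y₀`, is then injective, and so
surjective. -/
theorem exists_periodic_solution_of_unique [FiniteDimensional ℝ E] {T : ℝ} (hT : 0 < T)
    (hB : Continuous B) (hBp : Function.Periodic B T) {G : ℝ → E} (hG : Continuous G)
    (hGp : Function.Periodic G T)
    (huniq : ∀ y : ℝ → E, (∀ t, HasDerivAt y (B t (y t)) t) → Function.Periodic y T → y = 0) :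
    ∃ y : ℝ → E, (∀ t, HasDerivAt y (B t (y t) + G t) t) ∧ Function.Periodic y T := by
  obtain ⟨S, hS⟩ := exists_volterra_resolvent (B := B) hT.le hB
  have hT' : T ∈ Icc 0 T := ⟨hT.le, le_rfl⟩
  -- `D x` is the mismatch at the end of the period of the homogeneous solution starting at `x`
  let D : E →ₗ[ℝ] E :=
    { toFun := fun x => x - S (BoundedContinuousFunction.const ℝ x) T
      map_add' := fun x z => by
        have : BoundedContinuousFunction.const ℝ (x + z)
            = BoundedContinuousFunction.const ℝ x + BoundedContinuousFunction.const ℝ z := rfl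
        rw [this, map_add, BoundedContinuousFunction.add_apply]
        abel
      map_smul' := fun r x => by
        have : BoundedContinuousFunction.const ℝ (r • x)
            = r • BoundedContinuousFunction.const ℝ x := rfl
        rw [this, map_smul, BoundedContinuousFunction.smul_apply, RingHom.id_apply, smul_sub] }
  have hDinj : Function.Injective D := by
    refine (injective_iff_map_eq_zero D).2 fun x hx => ?_
    obtain ⟨y, hy, hyp, hy0⟩ := exists_periodic_extension hT (f := fun t z => B t z)
      (Y := S (BoundedContinuousFunction.const ℝ x))
      ((hB.comp continuous_fst).clm_apply continuous_snd) (fun t z => by rw [hBp t])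
      (S _).continuous (y₀ := x) (sub_eq_zero.1 hx).symm (fun t ht => hS _ t ht)
    rw [← hy0, huniq y hy hyp]
    rfl
  let P := clampedPrimitive hT.le G hG
  obtain ⟨x, hx⟩ := LinearMap.injective_iff_surjective.1 hDinj (S P T)
  have hSadd (t : ℝ) : S (BoundedContinuousFunction.const ℝ x + P) t
      = S (BoundedContinuousFunction.const ℝ x) t + S P t := by rw [map_add]; rfl
  obtain ⟨y, hy, hyp, -⟩ := exists_periodic_extension hT (f := fun t z => B t z + G t)
    (Y := S (BoundedContinuousFunction.const ℝ x + P))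
    (((hB.comp continuous_fst).clm_apply continuous_snd).add (hG.comp continuous_fst))
    (fun t z => by rw [hBp t, hGp t]) (S _).continuous (y₀ := x)
    (by rw [hSadd, ← hx]; simp [D]) (fun t ht => by
      have hc : Continuous fun s => B s (S (BoundedContinuousFunction.const ℝ x + P) s) :=
        hB.clm_apply (S _).continuous
      rw [integral_add (hc.intervalIntegrable _ _) (hG.intervalIntegrable _ _), hS _ t ht,
        BoundedContinuousFunction.add_apply, BoundedContinuousFunction.const_apply,
        clampedPrimitive_of_mem hT.le G hG ht]
      abel)
  exact ⟨y, hy, hyp⟩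

end PeriodicLinearODE

/-! ### Ordinary differential operators on the circle -/

namespace PlaneCurve

/-- Bootstrapping: each order of differentiability of `y` passes to `y' = B y + G`. -/
theorem contDiff_of_hasDerivAt_linear {E : Type*} [NormedAddCommGroup E] [NormedSpace ℝ E]
    {B : ℝ → E →L[ℝ] E} {G y : ℝ → E} (hB : ContDiff ℝ ∞ B) (hG : ContDiff ℝ ∞ G)
    (hy : ∀ t, HasDerivAt y (B t (y t) + G t) t) : ContDiff ℝ ∞ y := by
  have hderiv : deriv y = fun t => B t (y t) + G t := funext fun t => (hy t).deriv
  have hdiff : Differentiable ℝ y := fun t => (hy t).differentiableAt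
  rw [contDiff_infty]
  intro k
  induction k with
  | zero => exact contDiff_zero.2 hdiff.continuous
  | succ k ih =>
    push_cast
    refine contDiff_succ_iff_deriv.2 ⟨hdiff, by simp, ?_⟩
    rw [hderiv]
    have hk : ((k : ℕ∞) : WithTop ℕ∞) ≤ ∞ := by exact_mod_cast le_top
    exact ((hB.of_le hk).clm_apply ih).add (hG.of_le hk)

theorem smooth_ext {E : Type} [NormedAddCommGroup E] [NormedSpace ℝ E] {f g : Smooth E}
    (h : ∀ t : ℝ, f.1 (t : S1) = g.1 (t : S1)) : f = g := by
  ext x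
  induction x using QuotientAddGroup.induction_on with
  | H t => exact h t

theorem exists_smooth_of_periodic {E : Type} [NormedAddCommGroup E] [NormedSpace ℝ E] {φ : ℝ → E}
    (hφ : ContDiff ℝ ∞ φ) (hp : Function.Periodic φ (2 * Real.pi)) :
    ∃ f : Smooth E, ∀ t : ℝ, f.1 (t : S1) = φ t :=
  ⟨⟨hp.lift, hφ⟩, fun _ => rfl⟩

theorem dTheta_coe {E : Type} [NormedAddCommGroup E] [NormedSpace ℝ E] (f : Smooth E) (t : ℝ) :
    (dTheta f).1 (t : S1) = deriv (fun t : ℝ => f.1 (t : S1)) t :=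
  angDeriv_coe f.1 t

theorem hasDerivAt_lift {E : Type} [NormedAddCommGroup E] [NormedSpace ℝ E] (f : Smooth E)
    (t : ℝ) : HasDerivAt (fun t : ℝ => f.1 (t : S1)) ((dTheta f).1 (t : S1)) t := by
  rw [dTheta_coe]
  exact ((contDiff_lift f).differentiable (by simp) t).hasDerivAt

/-- The reciprocal of a nowhere vanishing smooth function. -/
noncomputable def invSmooth (a : Smooth ℝ) (ha : ∀ x, a.1 x ≠ 0) : Smooth ℝ :=
  ⟨fun x => (a.1 x)⁻¹, (contDiff_lift a).inv fun t => ha t⟩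

theorem val_sum_mulLeft (a : ℕ → Smooth ℝ) (f : Smooth ℝ) (s : Finset ℕ) (x : S1) :
    (∑ j ∈ s, mulLeft (a j) ((dTheta ^ j) f)).1 x
      = ∑ j ∈ s, (a j).1 x * ((dTheta ^ j) f).1 x := by
  rw [AddSubmonoidClass.coe_finsetSum, Finset.sum_apply]
  rfl

variable {m : ℕ}

/-- The companion matrix with last row `-b`: the system `y' = B y` on `ℝ^(m+1)` is the scalar
equation `y₀^(m+1) = -∑ b_j y₀^(j)`. -/
noncomputable def companion (b : Fin (m + 1) → ℝ → ℝ) (t : ℝ) :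
    (Fin (m + 1) → ℝ) →L[ℝ] (Fin (m + 1) → ℝ) :=
  ContinuousLinearMap.pi (Fin.snoc (fun i : Fin m => ContinuousLinearMap.proj i.succ) 0)
    - ∑ j, b j t • (ContinuousLinearMap.proj (R := ℝ) (φ := fun _ : Fin (m + 1) => ℝ) j).smulRight
        (Pi.single (Fin.last m) (1 : ℝ) : Fin (m + 1) → ℝ)

theorem companion_castSucc (b : Fin (m + 1) → ℝ → ℝ) (t : ℝ) (y : Fin (m + 1) → ℝ) (i : Fin m) :
    companion b t y i.castSucc = y i.succ := by
  simp [companion, Finset.sum_apply]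

theorem companion_last (b : Fin (m + 1) → ℝ → ℝ) (t : ℝ) (y : Fin (m + 1) → ℝ) :
    companion b t y (Fin.last m) = -∑ j, b j t * y j := by
  simp [companion, Finset.sum_apply]

theorem contDiff_companion {b : Fin (m + 1) → ℝ → ℝ} (hb : ∀ j, ContDiff ℝ ∞ (b j)) :
    ContDiff ℝ ∞ (companion b) := by
  unfold companion
  exact contDiff_const.sub (ContDiff.sum fun j _ => (hb j).smul contDiff_const)

/-- A periodic solution of the companion system of `∑ a_j ∂^j f = g` consists of the derivatives of
a smooth solution of that equation. -/
theorem exists_smooth_of_companion {a : ℕ → Smooth ℝ} (ha : ∀ x, (a (m + 1)).1 x ≠ 0)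
    (g : Smooth ℝ) {y : ℝ → Fin (m + 1) → ℝ}
    (hy : ∀ t, HasDerivAt y
      (companion (fun j t => (a j).1 (t : S1) / (a (m + 1)).1 (t : S1)) t (y t)
        + Pi.single (Fin.last m) (g.1 (t : S1) / (a (m + 1)).1 (t : S1))) t)
    (hyp : Function.Periodic y (2 * Real.pi)) :
    ∃ f : Smooth ℝ, (∀ (k : ℕ) (hk : k < m + 1) (t : ℝ),
        ((dTheta ^ k) f).1 (t : S1) = y t ⟨k, hk⟩) ∧
      ∑ j ∈ Finset.range (m + 1 + 1), mulLeft (a j) ((dTheta ^ j) f) = g := by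
  have hquot (h : Smooth ℝ) :
      ContDiff ℝ ∞ fun t : ℝ => h.1 (t : S1) / (a (m + 1)).1 (t : S1) :=
    (contDiff_lift h).div (contDiff_lift _) fun t => ha t
  have hG : ContDiff ℝ ∞ fun t : ℝ => (Pi.single (Fin.last m)
      (g.1 (t : S1) / (a (m + 1)).1 (t : S1)) : Fin (m + 1) → ℝ) :=
    (ContinuousLinearMap.single ℝ (fun _ : Fin (m + 1) => ℝ) (Fin.last m)).contDiff.comp (hquot g)
  have hys : ContDiff ℝ ∞ y :=
    contDiff_of_hasDerivAt_linear (contDiff_companion fun j => hquot (a j)) hG hy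
  obtain ⟨f, hf⟩ := exists_smooth_of_periodic (φ := fun t => y t 0) (contDiff_pi.1 hys 0)
    fun t => by simp only [hyp t]
  have hk : ∀ (k : ℕ) (hk : k < m + 1) (t : ℝ),
      ((dTheta ^ k) f).1 (t : S1) = y t ⟨k, hk⟩ := by
    intro k
    induction k with
    | zero => intro _ t; exact hf t
    | succ k ih =>
      intro hk t
      rw [pow_succ', Module.End.mul_apply, dTheta_coe]
      simp only [ih (by omega)]
      have h := hasDerivAt_pi.1 (hy t) (Fin.castSucc ⟨k, by omega⟩)
      rw [Pi.add_apply, companion_castSucc, Pi.single_eq_of_ne (Fin.castSucc_lt_last _).ne,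
        add_zero] at h
      exact h.deriv
  refine ⟨f, hk, smooth_ext fun t => ?_⟩
  have hlast : ((dTheta ^ (m + 1)) f).1 (t : S1)
      = -(∑ j : Fin (m + 1), (a j).1 (t : S1) / (a (m + 1)).1 (t : S1) * y t j)
        + g.1 (t : S1) / (a (m + 1)).1 (t : S1) := by
    rw [pow_succ', Module.End.mul_apply, dTheta_coe]
    simp only [hk m (Nat.lt_succ_self m)]
    have h := hasDerivAt_pi.1 (hy t) (Fin.last m)
    rw [Pi.add_apply, companion_last, Pi.single_eq_same] at h
    exact h.deriv
  rw [val_sum_mulLeft, Finset.sum_range_succ, Finset.sum_range, hlast, mul_add, mul_neg,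
    Finset.mul_sum, mul_div_cancel₀ _ (ha t)]
  have hsum : ∀ j : Fin (m + 1), (a (m + 1)).1 (t : S1)
      * ((a j).1 (t : S1) / (a (m + 1)).1 (t : S1) * y t j)
      = (a j).1 (t : S1) * ((dTheta ^ (j : ℕ)) f).1 (t : S1) := fun j => by
    have := ha t
    rw [hk j j.2]
    field_simp
  simp only [hsum]
  ring

/-- The Fredholm alternative for an ordinary differential operator on the circle whose leading
coefficient vanishes nowhere. -/
theorem surjective_of_injective_of_leadingCoeff_ne_zero {N : ℕ} {P : Smooth ℝ →ₗ[ℝ] Smooth ℝ}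
    {a : ℕ → Smooth ℝ} (ha : ∀ x, (a N).1 x ≠ 0)
    (hP : ∀ f, P f = ∑ j ∈ Finset.range (N + 1), mulLeft (a j) ((dTheta ^ j) f))
    (hinj : Function.Injective P) : Function.Surjective P := by
  intro g
  -- the companion system needs positive order; order zero is division by the coefficient
  rcases N with _ | m
  · refine ⟨mulLeft (invSmooth (a 0) ha) g, smooth_ext fun t => ?_⟩
    rw [hP, val_sum_mulLeft, Finset.sum_range_one]
    exact mul_inv_cancel_left₀ (ha t) _
  have hquot (h : Smooth ℝ) :
      ContDiff ℝ ∞ fun t : ℝ => h.1 (t : S1) / (a (m + 1)).1 (t : S1) :=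
    (contDiff_lift h).div (contDiff_lift _) fun t => ha t
  obtain ⟨y, hy, hyp⟩ := exists_periodic_solution_of_unique Real.two_pi_pos
    (B := companion (m := m) fun j t => (a j).1 (t : S1) / (a (m + 1)).1 (t : S1))
    (G := fun t : ℝ => Pi.single (Fin.last m) (g.1 (t : S1) / (a (m + 1)).1 (t : S1)))
    (contDiff_companion fun j => hquot (a j)).continuous
    (fun t => by simp only [companion, AddCircle.coe_add_period])
    ((ContinuousLinearMap.single ℝ (fun _ : Fin (m + 1) => ℝ) (Fin.last m)).continuous.comp
      (hquot g).continuous)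
    (fun t => by simp only [AddCircle.coe_add_period]) (fun y hy hyp => by
      obtain ⟨f, hfk, hf⟩ := exists_smooth_of_companion ha 0 (y := y)
        (fun t => by simpa using hy t) hyp
      have hf0 : f = 0 := hinj (by rw [hP, hf, map_zero])
      funext t i
      rw [← Fin.eta i i.2, ← hfk i i.2 t, hf0, map_zero]
      rfl)
  obtain ⟨f, -, hf⟩ := exists_smooth_of_companion ha g hy hyp
  exact ⟨f, by rw [hP, hf]⟩

end PlaneCurve

/-! ### The tangential operator as a differential operator -/

namespace PlaneCurve

namespace Imm

variable (c : Imm)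

theorem norm_tangent (x : S1) : ‖c.tangent.1 x‖ = 1 := by
  change ‖(c.speed x)⁻¹ • (dTheta c.curve).1 x‖ = 1
  rw [norm_smul, norm_inv, Real.norm_of_nonneg (c.speed_pos x).le]
  exact inv_mul_cancel₀ (c.speed_pos x).ne'

theorem dTheta_mulRight (h : Smooth Plane) (f : Smooth ℝ) :
    dTheta (mulRight h f) = mulRight h (dTheta f) + mulRight (dTheta h) f := by
  refine smooth_ext fun t => ?_
  have h1 := ((hasDerivAt_lift f t).smul (hasDerivAt_lift h t)).deriv
  rw [dTheta_coe]
  refine Eq.trans h1 ?_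
  rw [add_comm]
  rfl

theorem Ds_mulRight (h : Smooth Plane) (f : Smooth ℝ) :
    c.Ds (mulRight h f) = mulRight (mulLeft c.speedInv h) (dTheta f) + mulRight (c.Ds h) f := by
  simp only [Ds, LinearMap.comp_apply, dTheta_mulRight, map_add]
  congr 1 <;> · ext1; funext x; exact smul_comm _ _ _

theorem mulRight_zero_left (f : Smooth ℝ) : mulRight (0 : Smooth Plane) f = 0 := by
  ext1; funext x; exact smul_zero _

theorem mulRight_add_left (h k : Smooth Plane) (f : Smooth ℝ) :
    mulRight (h + k) f = mulRight h f + mulRight k f := by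
  ext1; funext x; exact smul_add _ _ _

/-- The Leibniz expansion of `D_s^k (f w)` in the derivatives of `f`. -/
theorem exists_Ds_pow_mulRight_eq_sum (w : Smooth Plane) (k : ℕ) :
    ∃ h : ℕ → Smooth Plane, (∀ j, k < j → h j = 0) ∧
      (∀ x, (h k).1 x = (c.speedInv.1 x) ^ k • w.1 x) ∧
      ∀ f, (c.Ds ^ k) (mulRight w f)
        = ∑ j ∈ Finset.range (k + 1), mulRight (h j) ((dTheta ^ j) f) := by
  induction k with
  | zero =>
    refine ⟨fun j => if j = 0 then w else 0, fun j hj => if_neg hj.ne', fun x => by simp,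
      fun f => by simp⟩
  | succ k ih =>
    obtain ⟨h, hzero, hlead, hsum⟩ := ih
    -- each term contributes `|c_θ|⁻¹ h_j` in order `j + 1` and `D_s h_j` in order `j`
    let h' : ℕ → Smooth Plane := fun j =>
      Nat.casesOn j (c.Ds (h 0)) fun j => mulLeft c.speedInv (h j) + c.Ds (h (j + 1))
    refine ⟨h', fun j hj => ?_, fun x => ?_, fun f => ?_⟩
    · obtain ⟨j, rfl⟩ : ∃ i, j = i + 1 := ⟨j - 1, by omega⟩
      simp only [h', hzero j (by omega), hzero (j + 1) (by omega), map_zero, add_zero]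
    · simp only [h', hzero (k + 1) (Nat.lt_succ_self k), map_zero, add_zero]
      change c.speedInv.1 x • (h k).1 x = _
      rw [hlead, smul_smul, pow_succ']
    · have hDs : ∑ j ∈ Finset.range (k + 1), mulRight (c.Ds (h j)) ((dTheta ^ j) f)
          = ∑ j ∈ Finset.range (k + 1 + 1), mulRight (c.Ds (h j)) ((dTheta ^ j) f) := by
        rw [Finset.sum_range_succ _ (k + 1), hzero (k + 1) (Nat.lt_succ_self k), map_zero,
          mulRight_zero_left, add_zero]
      rw [pow_succ', Module.End.mul_apply, hsum, map_sum]
      simp only [Ds_mulRight]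
      rw [Finset.sum_add_distrib, hDs, Finset.sum_range_succ' _ (k + 1),
        Finset.sum_range_succ' _ (k + 1), ← add_assoc, ← Finset.sum_add_distrib]
      simp only [h', mulRight_add_left, pow_succ', Module.End.mul_apply]
      rfl

theorem innerWith_mulRight (k h : Smooth Plane) (f : Smooth ℝ) :
    innerWith k (mulRight h f) = mulLeft (innerWith k h) f := by
  ext1; funext x
  change ⟪f.1 x • h.1 x, k.1 x⟫ = ⟪h.1 x, k.1 x⟫ * f.1 x
  rw [real_inner_smul_left, mul_comm]

theorem Ltop_apply (A : ℝ) (n : ℕ) (f : Smooth ℝ) :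
    c.Ltop A n f = innerWith c.tangent (mulRight c.tangent f)
      + ((-1) ^ n * A) • innerWith c.tangent ((c.Ds ^ (2 * n)) (mulRight c.tangent f)) := by
  simp only [Ltop, L, LinearMap.comp_apply, LinearMap.add_apply, LinearMap.id_apply,
    LinearMap.smul_apply, map_add, map_smul]

/-- The coefficients are the tangential components of those of the Leibniz expansion. -/
theorem exists_coeff_Ltop {A : ℝ} (hA : 0 < A) (n : ℕ) :
    ∃ a : ℕ → Smooth ℝ, (∀ x, (a (2 * n)).1 x ≠ 0) ∧
      ∀ f, c.Ltop A n f
        = ∑ j ∈ Finset.range (2 * n + 1), mulLeft (a j) ((dTheta ^ j) f) := by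
  obtain ⟨h, -, hlead, hsum⟩ := c.exists_Ds_pow_mulRight_eq_sum c.tangent (2 * n)
  refine ⟨fun j => (if j = 0 then innerWith c.tangent c.tangent else 0)
    + ((-1) ^ n * A) • innerWith c.tangent (h j), fun x => ?_, fun f => ?_⟩
  · have htt : inner ℝ (c.tangent.1 x) (c.tangent.1 x) = 1 := by
      rw [real_inner_self_eq_norm_sq, norm_tangent, one_pow]
    have htt' : (innerWith c.tangent c.tangent).1 x = 1 := htt
    have hh : (innerWith c.tangent (h (2 * n))).1 x = (c.speedInv.1 x) ^ (2 * n) := by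
      change inner ℝ ((h (2 * n)).1 x) (c.tangent.1 x) = _
      rw [hlead, real_inner_smul_left, htt, mul_one]
    have hpos : 0 < c.speedInv.1 x := inv_pos.2 (c.speed_pos x)
    -- for `n = 0` the identity and `A D_s^0` both contribute to the coefficient of order zero
    rcases n with _ | n
    · have : (1 : ℝ) + A ≠ 0 := by positivity
      rw [Nat.mul_zero, pow_zero] at hh
      simpa [hh, htt'] using this
    · simp [hh, hA.ne', hpos.ne']
  · rw [Ltop_apply, hsum, map_sum, innerWith_mulRight, Finset.smul_sum]
    ext1; funext x
    rw [val_sum_mulLeft]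
    simp only [innerWith_mulRight]
    have hite : ∑ j ∈ Finset.range (2 * n + 1),
        (if j = 0 then innerWith c.tangent c.tangent else 0 : Smooth ℝ).1 x
          * ((dTheta ^ j) f).1 x = (mulLeft (innerWith c.tangent c.tangent) f).1 x := by
      rw [Finset.sum_eq_single_of_mem 0 (by simp) fun j _ hj => by simp [hj]]
      rfl
    simp only [Submodule.coe_add, Pi.add_apply, add_mul, Finset.sum_add_distrib, hite,
      AddSubmonoidClass.coe_finsetSum, Finset.sum_apply]
    congr 1
    exact Finset.sum_congr rfl fun j _ => by
      simp [mulLeft, mul_assoc]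

/-! ### The energy identity -/

theorem integral_ds (F : S1 → ℝ) :
    ∫ x, F x ∂c.ds = ∫ t in (0 : ℝ)..2 * Real.pi, c.speed (t : S1) * F (t : S1) := by
  have h := AddCircle.intervalIntegral_preimage (2 * Real.pi) 0 fun x => c.speed x * F x
  rw [zero_add] at h
  rw [h, ds, integral_withDensity_eq_integral_toReal_smul
    c.continuous_speed.measurable.ennreal_ofReal (by simp)]
  simp only [ENNReal.toReal_ofReal (c.speed_pos _).le, smul_eq_mul]

theorem integrable_ds {F : S1 → ℝ} (hF : Continuous F) : MeasureTheory.Integrable F c.ds :=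
  hF.integrable_of_hasCompactSupport (HasCompactSupport.of_compactSpace _)

theorem continuous_inner (h k : Smooth Plane) : Continuous fun x => ⟪h.1 x, k.1 x⟫ :=
  (continuous_smooth h).inner (continuous_smooth k)

/-- Integration by parts: the arclength derivative is skew for `ds`. -/
theorem integral_inner_Ds (h k : Smooth Plane) :
    ∫ x, ⟪(c.Ds h).1 x, k.1 x⟫ ∂c.ds = -∫ x, ⟪h.1 x, (c.Ds k).1 x⟫ ∂c.ds := by
  have hval (u : Smooth Plane) (x : S1) : (c.Ds u).1 x = (c.speed x)⁻¹ • (dTheta u).1 x := rfl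
  have hderiv (t : ℝ) : HasDerivAt (fun t : ℝ => ⟪h.1 (t : S1), k.1 (t : S1)⟫)
      (c.speed (t : S1) * (⟪h.1 (t : S1), (c.Ds k).1 (t : S1)⟫
        + ⟪(c.Ds h).1 (t : S1), k.1 (t : S1)⟫)) t := by
    have h1 := (hasDerivAt_lift h t).inner ℝ (hasDerivAt_lift k t)
    refine h1.congr_deriv ?_
    have := (c.speed_pos (t : S1)).ne'
    rw [hval, hval, real_inner_smul_left, real_inner_smul_right]
    field_simp
  have hcont := (continuous_inner h (c.Ds k)).add (continuous_inner (c.Ds h) k)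
  have hcoe : Continuous fun t : ℝ => (t : S1) := AddCircle.continuous_mk' _
  rw [eq_neg_iff_add_eq_zero, add_comm, ← MeasureTheory.integral_add
    (c.integrable_ds (continuous_inner _ _)) (c.integrable_ds (continuous_inner _ _)),
    integral_ds, intervalIntegral.integral_eq_sub_of_hasDerivAt (fun t _ => hderiv t)
      (((c.continuous_speed.comp hcoe).mul (hcont.comp hcoe)).intervalIntegrable _ _)]
  simp only [AddCircle.coe_period, QuotientAddGroup.mk_zero, sub_self]

theorem integral_inner_Ds_pow (k : ℕ) (h g : Smooth Plane) :
    ∫ x, ⟪((c.Ds ^ k) h).1 x, g.1 x⟫ ∂c.ds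
      = (-1) ^ k * ∫ x, ⟪h.1 x, ((c.Ds ^ k) g).1 x⟫ ∂c.ds := by
  induction k generalizing g with
  | zero => simp
  | succ k ih =>
    rw [pow_succ', Module.End.mul_apply, integral_inner_Ds, ih, ← Module.End.mul_apply,
      ← pow_succ, ← pow_succ']
    ring

/-- The energy identity for the tangential operator. -/
theorem integral_Ltop_mul (A : ℝ) (n : ℕ) (f g : Smooth ℝ) :
    ∫ x, (c.Ltop A n f).1 x * g.1 x ∂c.ds = ∫ x, f.1 x * g.1 x ∂c.ds
      + A * ∫ x, ⟪((c.Ds ^ n) (mulRight c.tangent f)).1 x,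
          ((c.Ds ^ n) (mulRight c.tangent g)).1 x⟫ ∂c.ds := by
  have hpt (x : S1) : (c.Ltop A n f).1 x * g.1 x = f.1 x * g.1 x
      + ((-1) ^ n * A) * ⟪((c.Ds ^ (2 * n)) (mulRight c.tangent f)).1 x,
          (mulRight c.tangent g).1 x⟫ := by
    rw [Ltop_apply]
    change (⟪f.1 x • c.tangent.1 x, c.tangent.1 x⟫ + ((-1) ^ n * A)
      * ⟪((c.Ds ^ (2 * n)) (mulRight c.tangent f)).1 x, c.tangent.1 x⟫) * g.1 x
      = f.1 x * g.1 x + ((-1) ^ n * A)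
      * ⟪((c.Ds ^ (2 * n)) (mulRight c.tangent f)).1 x, g.1 x • c.tangent.1 x⟫
    rw [real_inner_smul_left, real_inner_smul_right, real_inner_self_eq_norm_sq, norm_tangent]
    ring
  simp only [hpt]
  rw [MeasureTheory.integral_add
    (c.integrable_ds (F := fun x => f.1 x * g.1 x)
      ((continuous_smooth f).mul (continuous_smooth g)))
    ((c.integrable_ds (continuous_inner _ _)).const_mul _), MeasureTheory.integral_const_mul,
    two_mul n, pow_add, Module.End.mul_apply, integral_inner_Ds_pow, ← mul_assoc]
  congr 2
  rw [mul_right_comm, ← mul_pow]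
  simp

theorem inner_toL2 (f g : Smooth ℝ) :
    inner ℝ (c.toL2 f) (c.toL2 g) = ∫ x, f.1 x * g.1 x ∂c.ds := by
  refine (MeasureTheory.ContinuousMap.inner_toLp (𝕜 := ℝ) c.ds _ _).trans ?_
  simp [mul_comm]

theorem Ltop_symm (A : ℝ) (n : ℕ) (f g : Smooth ℝ) :
    ∫ x, (c.Ltop A n f).1 x * g.1 x ∂c.ds = ∫ x, f.1 x * (c.Ltop A n g).1 x ∂c.ds := by
  have h : ∫ x, f.1 x * (c.Ltop A n g).1 x ∂c.ds = ∫ x, (c.Ltop A n g).1 x * f.1 x ∂c.ds := by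
    simp only [mul_comm]
  rw [h, integral_Ltop_mul, integral_Ltop_mul]
  simp only [mul_comm (f.1 _), real_inner_comm]

theorem norm_sq_le_inner_Ltop {A : ℝ} (hA : 0 < A) (n : ℕ) (f : Smooth ℝ) :
    ‖c.toL2 f‖ ^ 2 ≤ inner ℝ (c.toL2 (c.Ltop A n f)) (c.toL2 f) := by
  rw [inner_toL2, integral_Ltop_mul, ← inner_toL2, real_inner_self_eq_norm_sq]
  exact le_add_of_nonneg_right
    (mul_nonneg hA.le (MeasureTheory.integral_nonneg fun x => real_inner_self_nonneg))

theorem Ltop_pos {A : ℝ} (hA : 0 < A) (n : ℕ) {f : Smooth ℝ} (hf : f ≠ 0) :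
    0 < ∫ x, (c.Ltop A n f).1 x * f.1 x ∂c.ds := by
  rw [← inner_toL2]
  refine lt_of_lt_of_le ?_ (c.norm_sq_le_inner_Ltop hA n f)
  have : c.toL2 f ≠ 0 := (map_ne_zero_iff _ c.toL2_injective).2 hf
  positivity

theorem Ltop_bijective {A : ℝ} (hA : 0 < A) (n : ℕ) : Function.Bijective (c.Ltop A n) := by
  have hinj : Function.Injective (c.Ltop A n) := by
    refine (injective_iff_map_eq_zero _).2 fun f hf => ?_
    by_contra hne
    have := c.Ltop_pos hA n hne
    rw [hf] at this
    simp at this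
  obtain ⟨a, ha, hsum⟩ := c.exists_coeff_Ltop hA n
  exact ⟨hinj, surjective_of_injective_of_leadingCoeff_ne_zero ha hsum hinj⟩

end Imm

end PlaneCurve

/-! ### Unboundedness -/

namespace PlaneCurve

theorem exists_smooth_cos_sin (k : ℕ) : ∃ u w : Smooth ℝ,
    (∀ t : ℝ, u.1 (t : S1) = Real.cos (k * t)) ∧ (∀ t : ℝ, w.1 (t : S1) = Real.sin (k * t)) := by
  obtain ⟨u, hu⟩ := exists_smooth_of_periodic (φ := fun t : ℝ => Real.cos (k * t)) (by fun_prop)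
    fun t => by simp only [mul_add, Real.cos_add_nat_mul_two_pi]
  obtain ⟨w, hw⟩ := exists_smooth_of_periodic (φ := fun t : ℝ => Real.sin (k * t)) (by fun_prop)
    fun t => by simp only [mul_add, Real.sin_add_nat_mul_two_pi]
  exact ⟨u, w, hu, hw⟩

namespace Imm

variable (c : Imm)

theorem exists_norm_toL2_mulLeft_le (a : Smooth ℝ) :
    ∃ C : ℝ, 0 ≤ C ∧ ∀ f : Smooth ℝ, ‖c.toL2 (mulLeft a f)‖ ≤ C * ‖c.toL2 f‖ := by
  obtain ⟨C, hC⟩ := isCompact_univ.exists_bound_of_continuousOn (continuous_smooth a).continuousOn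
  have hC0 : 0 ≤ C := (norm_nonneg _).trans (hC 0 trivial)
  refine ⟨C, hC0, fun f => ?_⟩
  refine abs_le_of_sq_le_sq' ?_ (by positivity) |>.2
  rw [mul_pow, ← real_inner_self_eq_norm_sq, ← real_inner_self_eq_norm_sq, inner_toL2, inner_toL2,
    ← MeasureTheory.integral_const_mul]
  have hf := continuous_smooth f
  have hm := continuous_smooth (mulLeft a f)
  refine MeasureTheory.integral_mono (c.integrable_ds (hm.mul hm))
    ((c.integrable_ds (hf.mul hf)).const_mul _) fun x => ?_
  have h1 : (mulLeft a f).1 x * (mulLeft a f).1 x = a.1 x ^ 2 * (f.1 x * f.1 x) := by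
    change a.1 x * f.1 x * (a.1 x * f.1 x) = _
    ring
  simp only [h1]
  exact mul_le_mul_of_nonneg_right (sq_le_sq' (abs_le.1 (hC x trivial)).1
    (abs_le.1 (hC x trivial)).2) (mul_self_nonneg _)

/-- A differential operator of positive order with nowhere vanishing leading coefficient is
unbounded on `L²(ds)`. Write `M = ‖cos kθ‖ + ‖sin kθ‖`. The norms of the `j`-th derivatives of the
two functions add up to `k ^ j * M`; if `P` were bounded, expressing the derivative of order `N + 1`
through `P` and the lower derivatives would give `k ^ (N + 1) * M ≤ D * k ^ N * M` with `D`
independent of `k`. Working with the sum `M` makes a lower bound on `‖cos kθ‖` unnecessary. -/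
theorem not_bounded_of_leadingCoeff_ne_zero {N : ℕ} {P : Smooth ℝ →ₗ[ℝ] Smooth ℝ}
    {a : ℕ → Smooth ℝ} (ha : ∀ x, (a (N + 1)).1 x ≠ 0)
    (hP : ∀ f, P f = ∑ j ∈ Finset.range (N + 1 + 1), mulLeft (a j) ((dTheta ^ j) f)) :
    ¬ ∃ C : ℝ, ∀ f : Smooth ℝ, ‖c.toL2 (P f)‖ ≤ C * ‖c.toL2 f‖ := by
  rintro ⟨C, hC⟩
  choose K hK0 hK using fun j => c.exists_norm_toL2_mulLeft_le (a j)
  obtain ⟨I, hI0, hI⟩ := c.exists_norm_toL2_mulLeft_le (invSmooth _ ha)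
  set S := ∑ j ∈ Finset.range (N + 1), K j
  have hS0 : 0 ≤ S := Finset.sum_nonneg fun j _ => hK0 j
  obtain ⟨k, hk⟩ := exists_nat_gt (max 1 (2 * (I * (|C| + S))))
  have hk1 : (1 : ℝ) ≤ k := (le_max_left _ _).trans hk.le
  have hk2 : 2 * (I * (|C| + S)) < k := (le_max_right _ _).trans_lt hk
  obtain ⟨u, w, hu, hw⟩ := exists_smooth_cos_sin k
  have hdu : dTheta u = (-(k : ℝ)) • w := smooth_ext fun t => by
    rw [dTheta_coe]
    simp only [hu]
    have h := ((hasDerivAt_id t).const_mul (k : ℝ)).cos.deriv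
    refine h.trans ?_
    change _ = -(k : ℝ) * w.1 (t : S1)
    rw [hw]
    simp
    ring
  have hdw : dTheta w = (k : ℝ) • u := smooth_ext fun t => by
    rw [dTheta_coe]
    simp only [hw]
    have h := ((hasDerivAt_id t).const_mul (k : ℝ)).sin.deriv
    refine h.trans ?_
    change _ = (k : ℝ) * u.1 (t : S1)
    rw [hu]
    simp
    ring
  set M := ‖c.toL2 u‖ + ‖c.toL2 w‖ with hM
  have hM0 : 0 < M := by
    have hu0 : u ≠ 0 := fun h => by
      have := hu 0
      rw [h] at this
      simp at this
    have := norm_pos_iff.2 ((map_ne_zero_iff _ c.toL2_injective).2 hu0)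
    positivity
  -- differentiation swaps the two functions up to sign and a factor `k`
  have hswap : ∀ j : ℕ,
      ‖c.toL2 ((dTheta ^ j) u)‖ + ‖c.toL2 ((dTheta ^ j) w)‖ = (k : ℝ) ^ j * M := by
    intro j
    induction j with
    | zero => simp [hM]
    | succ j ih =>
      rw [pow_succ, Module.End.mul_apply, Module.End.mul_apply, hdu, hdw]
      simp only [map_smul, norm_smul, norm_neg, Real.norm_natCast]
      rw [← mul_add, add_comm ‖_‖, ih, pow_succ]
      ring
  have hupper : ∀ j : ℕ, ∀ f : Smooth ℝ, f = u ∨ f = w →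
      ‖c.toL2 ((dTheta ^ j) f)‖ ≤ (k : ℝ) ^ j * M := by
    rintro j f (rfl | rfl)
    · exact (le_add_of_nonneg_right (norm_nonneg _)).trans (hswap j).le
    · exact (le_add_of_nonneg_left (norm_nonneg _)).trans (hswap j).le
  have hlow : ∀ f : Smooth ℝ, f = u ∨ f = w →
      ‖c.toL2 ((dTheta ^ (N + 1)) f)‖ ≤ I * (|C| + S) * (k : ℝ) ^ N * M := by
    intro f hf
    have hlead : (dTheta ^ (N + 1)) f = mulLeft (invSmooth _ ha)
        (P f - ∑ j ∈ Finset.range (N + 1), mulLeft (a j) ((dTheta ^ j) f)) := by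
      rw [hP, Finset.sum_range_succ _ (N + 1), add_sub_cancel_left]
      ext1; funext x
      exact (inv_mul_cancel_left₀ (ha x) _).symm
    have hPf : ‖c.toL2 (P f)‖ ≤ |C| * ((k : ℝ) ^ N * M) := by
      have hfM : ‖c.toL2 f‖ ≤ M := by simpa using hupper 0 f hf
      calc ‖c.toL2 (P f)‖ ≤ C * ‖c.toL2 f‖ := hC f
        _ ≤ |C| * ‖c.toL2 f‖ := by gcongr; exact le_abs_self C
        _ ≤ |C| * ((k : ℝ) ^ N * M) := by
          gcongr
          exact hfM.trans (le_mul_of_one_le_left hM0.le (one_le_pow₀ hk1))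
    have hsum : ‖c.toL2 (∑ j ∈ Finset.range (N + 1), mulLeft (a j) ((dTheta ^ j) f))‖
        ≤ S * ((k : ℝ) ^ N * M) := by
      rw [map_sum, Finset.sum_mul]
      refine (norm_sum_le _ _).trans (Finset.sum_le_sum fun j hj => (hK j _).trans ?_)
      have := hK0 j
      gcongr
      refine (hupper j f hf).trans ?_
      gcongr
      exact Nat.lt_succ_iff.1 (Finset.mem_range.1 hj)
    rw [hlead]
    refine (hI _).trans ?_
    rw [map_sub]
    calc I * ‖c.toL2 (P f) - c.toL2 (∑ j ∈ Finset.range (N + 1), mulLeft (a j) ((dTheta ^ j) f))‖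
        ≤ I * (|C| * ((k : ℝ) ^ N * M) + S * ((k : ℝ) ^ N * M)) := by
          gcongr
          exact (norm_sub_le _ _).trans (add_le_add hPf hsum)
      _ = I * (|C| + S) * (k : ℝ) ^ N * M := by ring
  have h1 := add_le_add (hlow u (Or.inl rfl)) (hlow w (Or.inr rfl))
  rw [hswap] at h1
  have hkN : 0 < (k : ℝ) ^ N * M := by positivity
  have h2 : (k : ℝ) * ((k : ℝ) ^ N * M) ≤ 2 * (I * (|C| + S)) * ((k : ℝ) ^ N * M) := by
    calc (k : ℝ) * ((k : ℝ) ^ N * M) = (k : ℝ) ^ (N + 1) * M := by ring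
      _ ≤ _ := h1
      _ = _ := by ring
  exact absurd (le_of_mul_le_mul_right h2 hkN) (not_le.2 hk2)

end Imm

/-! ### The closure in `L²(ds)` -/

/-- The smooth functions as a subalgebra of the continuous functions on the circle. -/
noncomputable def smoothSubalgebra : Subalgebra ℝ C(S1, ℝ) where
  carrier := {f | ⇑f ∈ Smooth ℝ}
  mul_mem' {f g} hf hg := (mulLeft (⟨f, hf⟩ : Smooth ℝ) (⟨g, hg⟩ : Smooth ℝ)).2
  add_mem' hf hg := (Smooth ℝ).add_mem hf hg
  algebraMap_mem' r := (contDiff_const : ContDiff ℝ ∞ fun _ : ℝ => r)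

theorem smoothSubalgebra_separatesPoints : smoothSubalgebra.SeparatesPoints := by
  intro x y hxy
  obtain ⟨u, w, hu, hw⟩ := exists_smooth_cos_sin 1
  by_contra! h
  refine hxy ?_
  have h1 : u.1 x = u.1 y := h _ ⟨⟨u.1, continuous_smooth u⟩, u.2, rfl⟩
  have h2 : w.1 x = w.1 y := h _ ⟨⟨w.1, continuous_smooth w⟩, w.2, rfl⟩
  induction x using QuotientAddGroup.induction_on with
  | H s =>
    induction y using QuotientAddGroup.induction_on with
    | H t =>
      rw [hu, hu] at h1
      rw [hw, hw] at h2
      simp only [Nat.cast_one, one_mul] at h1 h2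
      exact Real.Angle.cos_sin_inj h1 h2

namespace Imm

variable (c : Imm)

theorem denseRange_toL2 : DenseRange c.toL2 := by
  have hdense : Dense (smoothSubalgebra : Set C(S1, ℝ)) := by
    have h := ContinuousMap.subalgebra_topologicalClosure_eq_top_of_separatesPoints _
      smoothSubalgebra_separatesPoints
    rw [dense_iff_closure_eq, ← Subalgebra.topologicalClosure_coe, h]
    rfl
  have hLp : DenseRange (ContinuousMap.toLp 2 c.ds ℝ : C(S1, ℝ) →L[ℝ] c.L2) :=
    ContinuousMap.toLp_denseRange ℝ c.ds ℝ (by simp)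
  refine (hLp.dense_image (ContinuousLinearMap.continuous _) hdense).mono ?_
  rintro _ ⟨f, hf, rfl⟩
  exact ⟨⟨f, hf⟩, rfl⟩

theorem asUnbounded_apply (P : Smooth ℝ →ₗ[ℝ] Smooth ℝ) {f : Smooth ℝ}
    {x : (c.asUnbounded P).domain} (hx : c.toL2 f = x) : c.asUnbounded P x = c.toL2 (P f) := by
  obtain rfl : x = ⟨c.toL2 f, f, rfl⟩ := Subtype.ext hx.symm
  exact congrArg (fun g => c.toL2 (P g))
    ((LinearEquiv.ofInjective c.toL2 c.toL2_injective).symm_apply_apply f)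

end Imm

end PlaneCurve

theorem mainTheorem3 (A : ℝ) (hA : 0 < A) (n : ℕ) (c : PlaneCurve.Imm) :
    -- invertibility on smooth functions
    Function.Bijective (c.Ltop A n) ∧
    -- differential operator of order `2n`
    PlaneCurve.IsDiffOpOfOrder (2 * n) (c.Ltop A n) ∧
    -- unbounded for the norm of `L²(ds)`
    (1 ≤ n → ¬ ∃ C : ℝ, ∀ f : PlaneCurve.Smooth ℝ, ‖c.toL2 (c.Ltop A n f)‖ ≤ C * ‖c.toL2 f‖) ∧
    -- symmetry and positivity on smooth functions
    (∀ f g : PlaneCurve.Smooth ℝ,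
      ∫ x, (c.Ltop A n f).1 x * g.1 x ∂c.ds = ∫ x, f.1 x * (c.Ltop A n g).1 x ∂c.ds) ∧
    (∀ f : PlaneCurve.Smooth ℝ, f ≠ 0 → 0 < ∫ x, (c.Ltop A n f).1 x * f.1 x ∂c.ds) ∧
    -- densely defined, closable, and the closure in `L²(ds)` is self-adjoint and positive
    Dense ((c.asUnbounded (c.Ltop A n)).domain : Set c.L2) ∧
    (c.asUnbounded (c.Ltop A n)).IsClosable ∧
    IsSelfAdjoint (c.asUnbounded (c.Ltop A n)).closure ∧
    (∀ u : (c.asUnbounded (c.Ltop A n)).closure.domain, u ≠ 0 →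
      0 < inner ℝ ((c.asUnbounded (c.Ltop A n)).closure u) (u : c.L2)) := by
  obtain ⟨a, ha, hsum⟩ := c.exists_coeff_Ltop hA n
  have hbij := c.Ltop_bijective hA n
  have hd : Dense ((c.asUnbounded (c.Ltop A n)).domain : Set c.L2) := c.denseRange_toL2
  have hs : (c.asUnbounded (c.Ltop A n)).IsFormalAdjoint (c.asUnbounded (c.Ltop A n)) := by
    rintro x y
    obtain ⟨f, hf⟩ := x.2
    obtain ⟨g, hg⟩ := y.2
    rw [c.asUnbounded_apply _ hf, c.asUnbounded_apply _ hg, ← hf, ← hg, c.inner_toL2,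
      c.inner_toL2, c.Ltop_symm]
  have hge (x : (c.asUnbounded (c.Ltop A n)).domain) :
      ‖(x : c.L2)‖ ^ 2 ≤ inner ℝ (c.asUnbounded (c.Ltop A n) x) (x : c.L2) := by
    obtain ⟨f, hf⟩ := x.2
    rw [c.asUnbounded_apply _ hf, ← hf]
    exact c.norm_sq_le_inner_Ltop hA n f
  have hr : DenseRange (c.asUnbounded (c.Ltop A n)) := by
    refine c.denseRange_toL2.mono ?_
    rintro _ ⟨g, rfl⟩
    obtain ⟨f, rfl⟩ := hbij.2 g
    exact ⟨⟨c.toL2 f, f, rfl⟩, c.asUnbounded_apply _ rfl⟩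
  have hc := hs.isClosable hd
  refine ⟨hbij, ⟨a, fun h => ha 0 (by rw [h]; rfl), hsum⟩, fun hn => ?_, c.Ltop_symm A n,
    fun f hf => c.Ltop_pos hA n hf, hd, hc,
    LinearPMap.isSelfAdjoint_closure_of_denseRange hd hs hge hr, fun u hu => ?_⟩
  · obtain ⟨N, hN⟩ : ∃ N, 2 * n = N + 1 := ⟨2 * n - 1, by omega⟩
    rw [hN] at ha hsum
    exact c.not_bounded_of_leadingCoeff_ne_zero ha hsum
  · have hu' : (u : c.L2) ≠ 0 := fun h => hu (Subtype.ext h)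
    exact (by positivity : 0 < ‖(u : c.L2)‖ ^ 2).trans_le
      (LinearPMap.norm_sq_le_inner_closure hc hge u)
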